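/- A \emph{tensor-triangulated category} is a triangulated category with a closed symmetric monoidal structure $(\otimes,\mathbb 1,\mathrm{hom})$ compatible with the triangulation: $\otimes$ commutes with shifts in each variable, compatibly with the symmetry, unit and associativity and with the usual sign $(-1)^{pq}$, and $\otimes$ and $\mathrm{hom}$ are exact in each variable. An object $x$ is \emph{compact} if $\mathrm{Hom}(x,-)$, with values in abelian groups, preserves small coproducts, and \emph{rigid} if $\mathrm{hom}(x,\mathbb 1)\otimes y\to \mathrm{hom}(x,y)$ is an isomorphism for all $y$. The category is \emph{rigidly-compactly generated} if it has small coproducts, there is a set $\mathcal G$ of compact objects such that $\mathrm{Hom}(g,t)=0$ for all $g\in\mathcal G$ implies $t=0$, and compact objects coincide with rigid objects. $\mathcal C^c$ denotes the full subcategory of compact objects, and $\mathrm{thick}(S)$ the smallest thick triangulated subcategory containing $S$. A \emph{(possibly external) dualizing object} for a full subcategory $\mathcal C_0\subset\mathcal C$ is an object $\kappa\in\mathcal C$, not necessarily in $\mathcal C_0$, such that $\mathrm{hom}(-,\kappa)$ restricts to an equivalence $\mathcal C_0^{\mathrm{op}}\to\mathcal C_0$; here $\mathcal C_0$ is required to be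 a $\mathcal C^c$-submodule, i.e. a thick triangulated subcategory with $c\otimes x\in\mathcal C_0$ for all $c\in\mathcal C^c$, $x\in\mathcal C_0$. \textbf{Theorem.} Let $\mathcal C,\mathcal D$ be rigidly-compactly generated tensor-triangulated categories and let $f^*:\mathcal D\to\mathcal C$ be a strong symmetric monoidal triangulated functor preserving small coproducts. Let $f_*:\mathcal C\to\mathcal D$ be its right adjoint and $f^{(1)}:\mathcal D\to\mathcal C$ the right adjoint of $f_*$ (these exist by Brown representability). (1) Let $\kappa'\in\mathcal C$ be a (possibly external) dualizing object for $\mathcal C_0\subset\mathcal C$ and let $\kappa\in\mathcal D$ be a Matlis lift of $\kappa'$, i.e. $f^{(1)}(\kappa)\cong\kappa'$. Then $\kappa$ is a (possibly external) dualizing object for $\mathrm{thick}(f_*(\mathcal C_0))\subset\mathcal D$; in particular the latter is a $\mathcal D^c$-submodule. (2) (Generalized Matlis duality of Dwyer--Greenlees--Iyengar, in tensor-triangular form.) Let $I\in\mathcal D$ be such that there are bijections $\mathrm{Hom}_{\mathcal C}(x,\mathbb 1)\cong\mathrm{Hom}_{\mathcal D}(f_*x,I)$ natural in $x\in\mathcal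 C$. Then $f^{(1)}(I)\cong\mathbb 1$, the unit $\mathbb 1$ is a dualizing object for $\mathcal C^c$, and $I$ is a (possibly external) dualizing object for $\mathrm{thick}(f_*(\mathcal C^c))$. If moreover $\mathcal C^c=\mathrm{thick}(\mathbb 1)$, then $I$ is a (possibly external) dualizing object for $\mathrm{thick}(f_*(\mathbb 1))$. (Case (2) covers $f^*=k\otimes^{\mathrm L}_R-:\mathrm{Der}(R)\to\mathrm{Der}(k)$ for a morphism $R\to k$ of commutative ring spectra, where $\mathrm{Der}(k)^c=\mathrm{thick}(k)$ and $f_*(\mathbb 1)$ is $k$ viewed as an $R$-module; classical Matlis duality is the case of a commutative noetherian local ring $R$ with residue field $k$ and $I=E(k)$.) -/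

import Mathlib

open CategoryTheory Category Limits MonoidalCategory Opposite
open scoped CategoryTheory.Pretriangulated.Opposite

universe v u u₁ u₂

namespace TTDuality


section Basic

variable (C : Type u) [Category.{v} C]

/-- A tensor-triangulated category: a triangulated category with a compatible closed symmetric
monoidal structure. The tensor product commutes with the shifts in each variable, the two ways
of pulling out a double shift `X⟦p⟧ ⊗ Y⟦q⟧ ≅ (X ⊗ Y)⟦p + q⟧` differing by the sign
`(-1) ^ (p * q)`; these isomorphisms are compatible with the symmetry, the unit and the
associativity; the tensor product and the internal hom are exact in each variable (exactness of
the internal hom in its second variable is automatic, since it is right adjoint to the tensor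
product). -/
class TensorTriangulated [HasZeroObject C] [Preadditive C] [HasShift C ℤ]
    [∀ n : ℤ, (shiftFunctor C n).Additive] [Pretriangulated C] [IsTriangulated C]
    [MonoidalCategory C] [SymmetricCategory C] [MonoidalClosed C] where
  [commShift₂ : (curriedTensor C).CommShift₂Int]
  braiding_shift (X Y : C) (n : ℤ) :
    (β_ (X⟦n⟧) Y).hom ≫ ((tensorLeft Y).commShiftIso n).hom.app X =
      ((tensorRight Y).commShiftIso n).hom.app X ≫ (β_ X Y).hom⟦n⟧'
  rightUnitor_shift (X : C) (n : ℤ) :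
    ((tensorRight (𝟙_ C)).commShiftIso n).hom.app X ≫ (ρ_ X).hom⟦n⟧' = (ρ_ (X⟦n⟧)).hom
  associator_shift (X Y Z : C) (n : ℤ) :
    ((tensorRight Y).commShiftIso n).hom.app X ▷ Z ≫
        ((tensorRight Z).commShiftIso n).hom.app (X ⊗ Y) ≫ (α_ X Y Z).hom⟦n⟧' =
      (α_ (X⟦n⟧) Y Z).hom ≫ ((tensorRight (Y ⊗ Z)).commShiftIso n).hom.app X
  isTriangulated_tensorLeft (X : C) : (tensorLeft X).IsTriangulated
  isTriangulated_tensorRight (X : C) : (tensorRight X).IsTriangulated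
  isTriangulated_internalHom (W : C) :
    ∃ _ : ((MonoidalClosed.internalHom (C := C)).flip.obj W).CommShift ℤ,
      ((MonoidalClosed.internalHom (C := C)).flip.obj W).IsTriangulated

/-- The compact objects: those `x` for which `Hom(x, -)`, with values in abelian groups, preserves
all small coproducts. -/
def compactObjects [Preadditive C] : ObjectProperty C := fun x =>
  ∀ J : Type v, PreservesColimitsOfShape (Discrete J) (preadditiveCoyoneda.obj (op x))

/-- Compact generation: small coproducts exist and a set of compact objects detects zero. -/
class IsCompactlyGenerated [Preadditive C] : Prop where
  hasCoproducts : HasCoproducts.{v} C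
  exists_generators : ∃ (ι : Type v) (G : ι → C), (∀ i, compactObjects C (G i)) ∧
    ∀ t : C, (∀ (i : ι) (g : G i ⟶ t), g = 0) → IsZero t

variable {C}

/-- The natural map `ihom(x, 𝟙) ⊗ y ⟶ ihom(x, y)`, adjoint to evaluation. -/
def rigidityMap [MonoidalCategory C] [MonoidalClosed C] (x y : C) :
    (ihom x).obj (𝟙_ C) ⊗ y ⟶ (ihom x).obj y :=
  MonoidalClosed.curry
    ((α_ x ((ihom x).obj (𝟙_ C)) y).inv ≫ (ihom.ev x).app (𝟙_ C) ▷ y ≫ (λ_ y).hom)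

/-- An object is rigid if `ihom(x, 𝟙) ⊗ y ⟶ ihom(x, y)` is an isomorphism for all `y`. -/
def IsRigid [MonoidalCategory C] [MonoidalClosed C] (x : C) : Prop :=
  ∀ y : C, IsIso (rigidityMap x y)

variable (C) in
/-- Rigid-compact generation: compactly generated, with compact objects = rigid objects. -/
class IsRigidlyCompactlyGenerated [Preadditive C] [MonoidalCategory C] [MonoidalClosed C] :
    Prop extends IsCompactlyGenerated C where
  compact_iff_rigid (x : C) : compactObjects C x ↔ IsRigid x

/-- The `κ`-twisted duality `ihom(-, κ)`. -/
def twistedDual [MonoidalCategory C] [MonoidalClosed C] (κ : C) : Cᵒᵖ ⥤ C :=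
  MonoidalClosed.internalHom.flip.obj κ

end Basic

section Subcategories

variable {C : Type u} [Category.{v} C] [HasZeroObject C] [Preadditive C] [HasShift C ℤ]
  [∀ n : ℤ, (shiftFunctor C n).Additive] [Pretriangulated C]

/-- The thick subcategory generated by `P`: the smallest triangulated subcategory closed under
retracts that contains `P` (see `ObjectProperty.triangEnvelope_le_iff`). -/
abbrev thick (P : ObjectProperty C) : ObjectProperty C := P.triangEnvelope

variable [MonoidalCategory C]

/-- A thick triangulated subcategory stable under tensoring with compact objects. -/
structure IsCompactSubmodule (P : ObjectProperty C) : Prop where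
  isTriangulated : P.IsTriangulated
  isStableUnderRetracts : P.IsStableUnderRetracts
  tensor_mem (c x : C) : compactObjects C c → P x → P (c ⊗ x)

variable [MonoidalClosed C]

/-- `κ` is a possibly external dualizing object for the full subcategory `P`: `P` is stable under
tensoring with compact objects, and `ihom(-, κ)` restricts to an equivalence `Pᵒᵖ ≌ P`.
It is not required that `P κ`. -/
structure IsDualizingObject (P : ObjectProperty C) (κ : C) : Prop where
  isCompactSubmodule : IsCompactSubmodule P
  dual_mem (x : C) : P x → P ((twistedDual κ).obj (op x))
  isEquivalence :
    (P.lift (P.ι.op ⋙ twistedDual κ)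
      (fun x : P.FullSubcategoryᵒᵖ => dual_mem x.unop.obj x.unop.property)).IsEquivalence

end Subcategories

end TTDuality

/-! Write L ⊣ F ⊣ R for f^* ⊣ f_* ⊣ f^(1). The duality hom(-, κ) is adjoint to itself on the right,
with unit the biduality map x ⟶ hom(hom(x, κ), κ). Hence it restricts to an equivalence on a
subcategory it preserves exactly when biduality is invertible on every object there
(`restrictedDual_isEquivalence_iff`).

For rigid c the projection formula F x ⊗ c ≅ F(x ⊗ L c) holds (`isIso_projectionMap`). Testing
against compact = rigid c, it gives F hom(x, R κ) ≅ hom(F x, κ) (`isIso_dualComparison`). This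
isomorphism carries biduality for R κ at x to biduality for κ at F x, so duality on C₀ passes to the
objects F x. Exactness propagates it to the thick closure, since the objects where biduality is
invertible after every shift form a thick subcategory. The projection formula also makes the closure
a submodule, as L preserves rigid objects.

For part (2), Yoneda gives R I ≅ 𝟙, and 𝟙 is dualizing on the rigid objects. -/

namespace TTDuality

/-! ### Rigid objects and exact pairings -/

section Rigid

variable {C : Type u} [Category.{v} C] [MonoidalCategory C] [MonoidalClosed C]

/-- The comparison map `y ⊗ z ⟶ ihom(x, z)` attached to a left dual `y` of `x`. -/
def dualTensorMap (y x z : C) [ExactPairing y x] : y ⊗ z ⟶ (ihom x).obj z :=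
  MonoidalClosed.curry ((α_ x y z).inv ≫ ε_ y x ▷ z ≫ (λ_ z).hom)

lemma isIso_of_comp_bijective {E : Type u} [Category.{v} E] {X Y : E} (f : X ⟶ Y)
    (hf : ∀ W : E, Function.Bijective (fun g : W ⟶ X => g ≫ f)) : IsIso f :=
  isIso_of_yoneda_map_bijective f hf

instance isIso_dualTensorMap (y x z : C) [ExactPairing y x] : IsIso (dualTensorMap y x z) := by
  refine isIso_of_comp_bijective _ fun w => ?_
  convert! ((tensorLeftHomEquiv w y x z).symm.trans
    ((ihom.adjunction x).homEquiv w z)).bijective using 1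
  ext g
  exact (MonoidalClosed.curry_natural_left g _).symm

lemma uncurry_rigidityMap (x y : C) : MonoidalClosed.uncurry (rigidityMap x y) =
    (α_ x ((ihom x).obj (𝟙_ C)) y).inv ≫ (ihom.ev x).app (𝟙_ C) ▷ y ≫ (λ_ y).hom :=
  MonoidalClosed.uncurry_curry _

/-- Evaluation and coevaluation of the internal dual of a rigid object. -/
noncomputable abbrev exactPairingOfIsRigid (x : C) (hx : IsRigid x) :
    ExactPairing ((ihom x).obj (𝟙_ C)) x :=
  haveI := hx x
  -- The coevaluation is the preimage of the name of the identity of x, so the first triangle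
  -- identity holds by construction.
  have h : x ◁ (MonoidalClosed.curry (ρ_ x).hom ≫ inv (rigidityMap x x)) ≫
      (α_ x _ x).inv ≫ (ihom.ev x).app (𝟙_ C) ▷ x ≫ (λ_ x).hom = (ρ_ x).hom := by
    have := congrArg MonoidalClosed.uncurry (show (MonoidalClosed.curry (ρ_ x).hom ≫
      inv (rigidityMap x x)) ≫ rigidityMap x x = MonoidalClosed.curry (ρ_ x).hom by simp)
    rwa [MonoidalClosed.uncurry_natural_left, MonoidalClosed.uncurry_curry,
      uncurry_rigidityMap] at this
  { coevaluation' := MonoidalClosed.curry (ρ_ x).hom ≫ inv (rigidityMap x x)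
    evaluation' := (ihom.ev x).app (𝟙_ C)
    coevaluation_evaluation' := by
      rw [← cancel_mono (λ_ x).hom]
      simpa using h
    evaluation_coevaluation' := by
      generalize MonoidalClosed.curry (ρ_ x).hom ≫ inv (rigidityMap x x) = c at h
      let e : x ⊗ (ihom x).obj (𝟙_ C) ⟶ 𝟙_ C := (ihom.ev x).app (𝟙_ C)
      change x ◁ c ≫ (α_ x _ x).inv ≫ e ▷ x ≫ (λ_ x).hom = (ρ_ x).hom at h
      change c ▷ _ ≫ (α_ _ x _).hom ≫ _ ◁ e = _
      rw [← cancel_mono (ρ_ _).hom]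
      -- Because e is evaluation, it suffices to compare after uncurrying; the exchange law then
      -- slides one copy of e past the other and exposes the first triangle identity.
      apply MonoidalClosed.uncurry_injective
      rw [MonoidalClosed.uncurry_eq, MonoidalClosed.uncurry_eq]
      change _ ≫ e = _ ≫ e
      have h' : x ◁ c ⊗≫ e ▷ x = ⊗𝟙.hom := by
        rw [← cancel_mono (λ_ x).hom]
        have : (⊗𝟙.hom : x ⊗ 𝟙_ C ⟶ 𝟙_ C ⊗ x) ≫ (λ_ x).hom = (ρ_ x).hom := by
          monoidal
        rw [this, ← h]
        monoidal
      calc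
        _ = 𝟙 _ ⊗≫ x ◁ c ▷ (ihom x).obj (𝟙_ C) ⊗≫
            ((x ⊗ (ihom x).obj (𝟙_ C)) ◁ e ≫ e ▷ (𝟙_ C)) ⊗≫ 𝟙 _ := by
          monoidal
        _ = 𝟙 _ ⊗≫ (x ◁ c ⊗≫ e ▷ x) ▷ (ihom x).obj (𝟙_ C) ⊗≫ e ⊗≫ 𝟙 _ := by
          rw [whisker_exchange]; monoidal
        _ = _ := by
          rw [h']; monoidal }

/-- Currying the evaluation identifies y with the internal dual of x, and this turns `rigidityMap`
into the invertible `dualTensorMap`. -/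
lemma isRigid_of_exactPairing (y x : C) [ExactPairing y x] : IsRigid x := by
  intro z
  have h₁ : (ρ_ y).inv ≫ dualTensorMap y x (𝟙_ C) = MonoidalClosed.curry (ε_ y x) := by
    rw [dualTensorMap, ← MonoidalClosed.curry_natural_left]
    congr 1
    monoidal
  have : IsIso (MonoidalClosed.curry (ε_ y x)) := by rw [← h₁]; infer_instance
  have h₂ : MonoidalClosed.curry (ε_ y x) ▷ z ≫ rigidityMap x z = dualTensorMap y x z := by
    rw [rigidityMap, dualTensorMap, ← MonoidalClosed.curry_natural_left,
      associator_inv_naturality_middle_assoc, ← comp_whiskerRight_assoc,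
      MonoidalClosed.whiskerLeft_curry_ihom_ev_app]
  have : IsIso (MonoidalClosed.curry (ε_ y x) ▷ z ≫ rigidityMap x z) := by
    rw [h₂]; infer_instance
  exact IsIso.of_isIso_comp_left (MonoidalClosed.curry (ε_ y x) ▷ z) _

lemma IsRigid.tensor {x y : C} (hx : IsRigid x) (hy : IsRigid y) : IsRigid (x ⊗ y) :=
  letI := exactPairingOfIsRigid x hx
  letI := exactPairingOfIsRigid y hy
  isRigid_of_exactPairing ((ihom y).obj (𝟙_ C) ⊗ (ihom x).obj (𝟙_ C)) (x ⊗ y)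

lemma IsRigid.dual [BraidedCategory C] {x : C} (hx : IsRigid x) :
    IsRigid ((ihom x).obj (𝟙_ C)) :=
  letI := exactPairingOfIsRigid x hx
  letI := BraidedCategory.exactPairing_swap ((ihom x).obj (𝟙_ C)) x
  isRigid_of_exactPairing x _

end Rigid

/-! ### Strong monoidal functors preserve rigidity -/

section MonoidalFunctor

variable {C : Type u₁} [Category.{v} C] [MonoidalCategory C]
  {D : Type u₂} [Category.{v} D] [MonoidalCategory D]

open Functor.LaxMonoidal Functor.OplaxMonoidal

/-- A strong monoidal functor preserves exact pairings. -/
abbrev exactPairingMap (F : D ⥤ C) [F.Monoidal] (y x : D) [ExactPairing y x] :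
    ExactPairing (F.obj y) (F.obj x) where
  coevaluation' := ε F ≫ F.map (η_ y x) ≫ δ F y x
  evaluation' := μ F x y ≫ F.map (ε_ y x) ≫ η F
  coevaluation_evaluation' := by
    have := congrArg F.map (ExactPairing.coevaluation_evaluation y x)
    simp only [Functor.map_comp, Functor.Monoidal.map_whiskerLeft,
      Functor.Monoidal.map_whiskerRight, Functor.Monoidal.map_associator_inv,
      Functor.Monoidal.map_leftUnitor_inv, Functor.Monoidal.map_rightUnitor] at this
    rw [← cancel_epi (F.obj x ◁ η F), ← cancel_epi (δ F x (𝟙_ D)),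
      ← cancel_mono (ε F ▷ F.obj x), ← cancel_mono (μ F (𝟙_ D) x)]
    simpa [← whisker_exchange_assoc] using this
  evaluation_coevaluation' := by
    have := congrArg F.map (ExactPairing.evaluation_coevaluation y x)
    simp only [Functor.map_comp, Functor.Monoidal.map_whiskerLeft,
      Functor.Monoidal.map_whiskerRight, Functor.Monoidal.map_associator,
      Functor.Monoidal.map_rightUnitor_inv, Functor.Monoidal.map_leftUnitor] at this
    rw [← cancel_epi (η F ▷ F.obj y), ← cancel_epi (δ F (𝟙_ D) y),
      ← cancel_mono (F.obj y ◁ ε F), ← cancel_mono (μ F y (𝟙_ D))]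
    simpa using this

lemma IsRigid.map [MonoidalClosed C] [MonoidalClosed D] (F : D ⥤ C) [F.Monoidal]
    {x : D} (hx : IsRigid x) : IsRigid (F.obj x) :=
  letI := exactPairingOfIsRigid x hx
  letI := exactPairingMap F ((ihom x).obj (𝟙_ D)) x
  isRigid_of_exactPairing (F.obj ((ihom x).obj (𝟙_ D))) (F.obj x)

end MonoidalFunctor

/-! ### Biduality and the criterion for a twisted duality to be an equivalence -/

section Biduality

variable {C : Type u} [Category.{v} C] [MonoidalCategory C] [SymmetricCategory C]
  [MonoidalClosed C]

/-- The canonical map from `x` to its double `κ`-twisted dual. -/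
def bidualityMap (κ x : C) : x ⟶ (ihom ((ihom x).obj κ)).obj κ :=
  MonoidalClosed.curry ((β_ ((ihom x).obj κ) x).hom ≫ (ihom.ev x).app κ)

lemma uncurry_bidualityMap (κ x : C) : MonoidalClosed.uncurry (bidualityMap κ x) =
    (β_ ((ihom x).obj κ) x).hom ≫ (ihom.ev x).app κ :=
  MonoidalClosed.uncurry_curry _

/-- Maps between twisted duals `ihom(x, κ) ⟶ ihom(w, κ)` correspond to maps
`w ⟶ ihom(ihom(x, κ), κ)`. -/
def twistedDualHomEquiv (κ w z : C) :
    (z ⟶ (ihom w).obj κ) ≃ (w ⟶ (ihom z).obj κ) :=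
  ((ihom.adjunction w).homEquiv z κ).symm.trans
    (((β_ w z).homFromEquiv).trans ((ihom.adjunction z).homEquiv w κ))

lemma twistedDualHomEquiv_apply (κ w z : C) (g : z ⟶ (ihom w).obj κ) :
    twistedDualHomEquiv κ w z g =
      MonoidalClosed.curry ((β_ z w).hom ≫ MonoidalClosed.uncurry g) := by
  change MonoidalClosed.curry ((β_ w z).inv ≫ MonoidalClosed.uncurry g) = _
  rw [← SymmetricCategory.braiding_swap_eq_inv_braiding]

/-- This is why full faithfulness of the duality is a property of biduality: its action on morphisms
is, up to a bijection, composition with `bidualityMap`. -/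
lemma twistedDualHomEquiv_pre (κ : C) {w x : C} (f : w ⟶ x) :
    twistedDualHomEquiv κ w _ ((MonoidalClosed.pre f).app κ) = f ≫ bidualityMap κ x := by
  rw [twistedDualHomEquiv_apply, bidualityMap, ← MonoidalClosed.curry_natural_left,
    MonoidalClosed.uncurry_pre, BraidedCategory.braiding_naturality_right_assoc]

lemma bidualityMap_naturality (κ : C) {w x : C} (f : w ⟶ x) :
    f ≫ bidualityMap κ x = bidualityMap κ w ≫
      (MonoidalClosed.pre ((MonoidalClosed.pre f).app κ)).app κ := by
  apply MonoidalClosed.uncurry_injective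
  rw [MonoidalClosed.uncurry_natural_left, MonoidalClosed.uncurry_pre_app,
    uncurry_bidualityMap, uncurry_bidualityMap, BraidedCategory.braiding_naturality_right_assoc,
    BraidedCategory.braiding_naturality_left_assoc, MonoidalClosed.id_tensor_pre_app_comp_ev]

/-- The biduality maps form a natural transformation. -/
@[simps]
def bidualityNatTrans (κ : C) : 𝟭 C ⟶ (opOp C ⋙ (twistedDual κ).op) ⋙ twistedDual κ where
  app x := bidualityMap κ x
  naturality _ _ f := bidualityMap_naturality κ f

/-- The braiding makes x a dual of its own dual; for that pairing, biduality is `dualTensorMap` up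
to a unitor. -/
lemma isIso_bidualityMap_unit {x : C} (hx : IsRigid x) : IsIso (bidualityMap (𝟙_ C) x) := by
  let := exactPairingOfIsRigid x hx
  let := BraidedCategory.exactPairing_swap ((ihom x).obj (𝟙_ C)) x
  have : (ρ_ x).inv ≫ dualTensorMap x ((ihom x).obj (𝟙_ C)) (𝟙_ C) = bidualityMap (𝟙_ C) x := by
    rw [dualTensorMap, bidualityMap, ← MonoidalClosed.curry_natural_left]
    congr 1
    change _ = ε_ x ((ihom x).obj (𝟙_ C))
    monoidal
  rw [← this]
  infer_instance

variable (P : ObjectProperty C) (κ : C)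
  (hP : ∀ x, P x → P ((twistedDual κ).obj (op x)))

/-- The restriction of the twisted duality to a full subcategory which it preserves. -/
abbrev restrictedDual : P.FullSubcategoryᵒᵖ ⥤ P.FullSubcategory :=
  P.lift (P.ι.op ⋙ twistedDual κ) fun x => hP x.unop.obj x.unop.property

lemma bijective_comp_bidualityMap_iff (w x : P.FullSubcategory) :
    Function.Bijective (fun f : w.obj ⟶ x.obj => f ≫ bidualityMap κ x.obj) ↔
      Function.Bijective (fun f : op x ⟶ op w => (restrictedDual P κ hP).map f) := by
  let a : (w.obj ⟶ x.obj) ≃ (op x ⟶ op w) :=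
    (P.fullyFaithfulι.homEquiv (X := w) (Y := x)).symm.trans Quiver.Hom.opEquiv
  let b := (P.fullyFaithfulι.homEquiv (X := (restrictedDual P κ hP).obj (op x))
    (Y := (restrictedDual P κ hP).obj (op w))).trans (twistedDualHomEquiv κ w.obj _)
  have : (fun f : w.obj ⟶ x.obj => f ≫ bidualityMap κ x.obj) =
      b ∘ (fun f : op x ⟶ op w => (restrictedDual P κ hP).map f) ∘ a := by
    ext f
    exact (twistedDualHomEquiv_pre κ f).symm
  exact this ▸ (b.comp_bijective _).trans (a.bijective_comp _)

lemma restrictedDual_isEquivalence_iff :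
    (restrictedDual P κ hP).IsEquivalence ↔ ∀ x, P x → IsIso (bidualityMap κ x) := by
  constructor
  · intro h x hx
    have bij (w : C) (hw : P w) :
        Function.Bijective (fun f : w ⟶ x => f ≫ bidualityMap κ x) :=
      (bijective_comp_bidualityMap_iff P κ hP ⟨w, hw⟩ ⟨x, hx⟩).2
        ⟨(restrictedDual P κ hP).map_injective, (restrictedDual P κ hP).map_surjective⟩
    -- Only sources in P can be tested, but the double dual of x again lies in P, so the Yoneda
    -- argument closes up inside P.
    obtain ⟨s, hs⟩ := (bij _ (hP _ (hP x hx))).2 (𝟙 _)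
    exact ⟨s, (bij x hx).1 ((Category.assoc _ _ _).trans
      ((congrArg (bidualityMap κ x ≫ ·) hs).trans
        ((Category.comp_id _).trans (Category.id_comp _).symm))), hs⟩
  · intro h
    have bij (x w : P.FullSubcategory) :
        Function.Bijective (fun f : op x ⟶ op w => (restrictedDual P κ hP).map f) := by
      have := h x.obj x.property
      refine (bijective_comp_bidualityMap_iff P κ hP w x).1 ⟨fun f g hfg => ?_, fun g => ?_⟩
      · exact (cancel_mono _).1 hfg
      · exact ⟨g ≫ inv (bidualityMap κ x.obj), by simp⟩
    exact
      { full := ⟨fun {x w} => (bij x.unop w.unop).2⟩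
        faithful := ⟨fun {x w} _ _ h => (bij x.unop w.unop).1 h⟩
        essSurj := ⟨fun x => by
          have := h x.obj x.property
          exact ⟨op ⟨_, hP _ x.property⟩, ⟨P.isoMk (asIso (bidualityMap κ x.obj)).symm⟩⟩⟩ }

end Biduality

/-! ### Dévissage for natural transformations -/

section Devissage

open Pretriangulated

variable {C : Type u₁} [Category.{v} C] [HasZeroObject C] [Preadditive C] [HasShift C ℤ]
  [∀ n : ℤ, (shiftFunctor C n).Additive] [Pretriangulated C]

section

variable {A : Type*} [Category* A] [Abelian A]

/-- Five lemma on the long exact sequence from T₃⟦-1⟧ to T₁⟦1⟧. Only naturality of τ enters, not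
compatibility with shifts; the price is assuming invertibility at shifted objects. -/
lemma isIso_app_of_isHomological {H₁ H₂ : C ⥤ A} [H₁.IsHomological] [H₂.IsHomological]
    (τ : H₁ ⟶ H₂) (T : Triangle C) (hT : T ∈ distTriang C)
    (h₀ : IsIso (τ.app (T.obj₃⟦(-1 : ℤ)⟧))) (h₁ : IsIso (τ.app T.obj₁))
    (h₃ : IsIso (τ.app T.obj₃)) (h₄ : IsIso (τ.app (T.obj₁⟦(1 : ℤ)⟧))) :
    IsIso (τ.app T.obj₂) := by
  let R (H : C ⥤ A) : ComposableArrows A 4 := ComposableArrows.mk₄ (H.map T.invRotate.mor₁)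
    (H.map T.mor₁) (H.map T.mor₂) (H.map T.mor₃)
  have hR (H : C ⥤ A) [H.IsHomological] : (R H).Exact :=
    ComposableArrows.exact_of_δ₀
      (H.map_distinguished_exact _ (inv_rot_of_distTriang _ hT)).exact_toComposableArrows
      (ComposableArrows.exact_of_δ₀ (H.map_distinguished_exact _ hT).exact_toComposableArrows
        (H.map_distinguished_exact _ (rot_of_distTriang _ hT)).exact_toComposableArrows)
  let φ : R H₁ ⟶ R H₂ := ComposableArrows.homMk₄ (τ.app _) (τ.app _) (τ.app _) (τ.app _) (τ.app _)
    (τ.naturality _) (τ.naturality _) (τ.naturality _) (τ.naturality _)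
  have e₀ : Epi (τ.app (T.obj₃⟦(-1 : ℤ)⟧)) := inferInstance
  have e₄ : Mono (τ.app (T.obj₁⟦(1 : ℤ)⟧)) := inferInstance
  exact Abelian.isIso_of_epi_of_isIso_of_isIso_of_mono (hR H₁) (hR H₂) φ e₀ h₁ h₃ e₄

end

variable {D : Type u₂} [Category.{v} D]

/-- The objects all of whose shifts are sent to isomorphisms by a natural transformation. -/
def isIsoLocus {F₁ F₂ : C ⥤ D} (τ : F₁ ⟶ F₂) : ObjectProperty C :=
  fun X => ∀ n : ℤ, IsIso (τ.app (X⟦n⟧))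

lemma isIso_app_of_retract {E : Type*} [Category* E] {F₁ F₂ : E ⥤ D} (τ : F₁ ⟶ F₂) {X Y : E}
    (r : Retract X Y) [IsIso (τ.app Y)] : IsIso (τ.app X) := by
  refine ⟨F₂.map r.i ≫ inv (τ.app Y) ≫ F₁.map r.r, ?_, ?_⟩
  · rw [← τ.naturality_assoc, IsIso.hom_inv_id_assoc, ← F₁.map_comp, r.retract, F₁.map_id]
  · rw [assoc, assoc, τ.naturality, IsIso.inv_hom_id_assoc, ← F₂.map_comp, r.retract, F₂.map_id]

lemma isIso_app_of_iso {E : Type*} [Category* E] {F₁ F₂ : E ⥤ D} (τ : F₁ ⟶ F₂) {X Y : E}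
    (e : X ≅ Y) [IsIso (τ.app Y)] : IsIso (τ.app X) :=
  isIso_app_of_retract τ (Retract.ofIso e)

omit [HasZeroObject C] [Preadditive C] [∀ n : ℤ, (shiftFunctor C n).Additive]
  [Pretriangulated C] in
lemma isIsoLocus_le {F₁ F₂ : C ⥤ D} (τ : F₁ ⟶ F₂) {X : C} (hX : isIsoLocus τ X) :
    IsIso (τ.app X) :=
  haveI := hX 0
  isIso_app_of_iso τ ((shiftFunctorZero C ℤ).symm.app X)

instance {F₁ F₂ : C ⥤ D} (τ : F₁ ⟶ F₂) : (isIsoLocus τ).IsStableUnderRetracts where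
  of_retract r hY n :=
    haveI := hY n
    isIso_app_of_retract τ (r.map (shiftFunctor C n))

instance {F₁ F₂ : C ⥤ D} (τ : F₁ ⟶ F₂) : (isIsoLocus τ).IsStableUnderShift ℤ where
  isStableUnderShiftBy a := ⟨fun X hX n =>
    haveI := hX (a + n)
    isIso_app_of_iso τ ((shiftFunctorAdd C a n).symm.app X)⟩

variable [HasZeroObject D] [Preadditive D] [HasShift D ℤ]
  [∀ n : ℤ, (shiftFunctor D n).Additive] [Pretriangulated D]

/-- Quantifying over all shifts in `isIsoLocus` replaces a compatibility of τ with the shift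
isomorphisms. Closure under extensions follows by applying Hom(W, -) and the five lemma. -/
instance {F₁ F₂ : C ⥤ D} [F₁.CommShift ℤ] [F₁.IsTriangulated] [F₂.CommShift ℤ]
    [F₂.IsTriangulated] (τ : F₁ ⟶ F₂) : (isIsoLocus τ).IsTriangulated where
  exists_zero := ⟨_, isZero_zero C, fun n =>
    ((F₁.map_isZero ((shiftFunctor C n).map_isZero (isZero_zero C))).isIso
      (F₂.map_isZero ((shiftFunctor C n).map_isZero (isZero_zero C))) _)⟩
  toIsTriangulatedClosed₂ := ObjectProperty.IsTriangulatedClosed₂.mk' fun T hT h₁ h₃ n => by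
    have hT' := Triangle.shift_distinguished T hT n
    refine isIso_of_comp_bijective _ fun W => ?_
    let σ := Functor.whiskerRight τ (preadditiveCoyoneda.obj (op W))
    have key (X : C) (hX : isIsoLocus τ X) (m : ℤ) : IsIso (σ.app (X⟦m⟧)) := by
      have := hX m
      dsimp [σ]
      infer_instance
    have : IsIso (σ.app (T.obj₂⟦n⟧)) :=
      isIso_app_of_isHomological σ _ hT'
        (isIsoLocus_le σ (fun m => key _ ((isIsoLocus τ).le_shift _ _
          ((isIsoLocus τ).le_shift _ _ h₃)) m)) (key _ h₁ n) (key _ h₃ n)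
        (isIsoLocus_le σ (fun m => key _ ((isIsoLocus τ).le_shift _ _
          ((isIsoLocus τ).le_shift _ _ h₁)) m))
    exact (ConcreteCategory.isIso_iff_bijective (σ.app (T.obj₂⟦n⟧))).1 this

end Devissage

/-! ### Compact objects detect isomorphisms -/

section Detection

open Pretriangulated

variable {C : Type u} [Category.{v} C] [HasZeroObject C] [Preadditive C] [HasShift C ℤ]
  [∀ n : ℤ, (shiftFunctor C n).Additive] [Pretriangulated C]

omit [HasZeroObject C] [Pretriangulated C] in
lemma compactObjects_shift {x : C} (hx : compactObjects C x) (n : ℤ) :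
    compactObjects C (x⟦n⟧) := by
  intro J
  have := hx J
  let e : shiftFunctor C (-n) ⋙ preadditiveCoyoneda.obj (op x) ≅
      preadditiveCoyoneda.obj (op (x⟦n⟧)) :=
    haveI : (shiftEquiv C n).functor.Additive := inferInstanceAs (shiftFunctor C n).Additive
    NatIso.ofComponents (fun W => AddEquiv.toAddCommGrpIso
      ((shiftEquiv C n).toAdjunction.homAddEquiv x W).symm) (fun f => by
        ext g
        exact (shiftEquiv C n).toAdjunction.homEquiv_naturality_right_symm g f)
  exact preservesColimitsOfShape_of_natIso e

lemma isIso_of_bijective_compactObjects [IsCompactlyGenerated C] {x y : C} (f : x ⟶ y)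
    (hf : ∀ c, compactObjects C c → Function.Bijective (fun g : c ⟶ x => g ≫ f)) : IsIso f := by
  obtain ⟨z, g, h, hT⟩ := distinguished_cocone_triangle f
  suffices IsZero z from (Triangle.isZero₃_iff_isIso₁ _ hT).1 this
  obtain ⟨ι, G, hG, hG'⟩ := IsCompactlyGenerated.exists_generators (C := C)
  refine hG' z fun i a => ?_
  -- Desuspended, a ≫ h is a map from the compact object `(G i)⟦-1⟧` to x killed by f, hence zero by
  -- injectivity. So a lifts to y, then by surjectivity to x, and vanishes in the cone.
  have h₁ : a ≫ h = 0 := by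
    let e := (shiftFunctorCompIsoId C (-1 : ℤ) 1 (by simp)).app (G i)
    obtain ⟨b, hb⟩ := (shiftFunctor C (1 : ℤ)).map_surjective (e.hom ≫ a ≫ h)
    have hb₀ : b ≫ f = 0 := by
      apply (shiftFunctor C (1 : ℤ)).map_injective
      have hf₀ : h ≫ f⟦(1 : ℤ)⟧' = 0 := comp_distTriang_mor_zero₃₁ _ hT
      rw [Functor.map_comp, hb, Functor.map_zero, assoc, assoc, hf₀, comp_zero, comp_zero]
    have hb₁ : b = 0 := (hf _ (compactObjects_shift (hG i) (-1))).1 (by simpa using hb₀)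
    rw [← cancel_epi e.hom, ← hb, hb₁]
    simp
  obtain ⟨b, rfl⟩ := Triangle.coyoneda_exact₃ _ hT a h₁
  obtain ⟨c, rfl⟩ := (hf _ (hG i)).2 b
  exact (assoc c f g).trans ((c ≫= comp_distTriang_mor_zero₁₂ _ hT).trans comp_zero)

end Detection

/-! ### Compact objects form a compact submodule -/

section TensorTriangulated

variable {C : Type u} [Category.{v} C] [HasZeroObject C] [Preadditive C] [HasShift C ℤ]
    [∀ n : ℤ, (shiftFunctor C n).Additive] [Pretriangulated C] [IsTriangulated C]
    [MonoidalCategory C] [SymmetricCategory C] [MonoidalClosed C]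
    [TensorTriangulated C]

instance : (curriedTensor C).CommShift₂Int := TensorTriangulated.commShift₂
noncomputable instance (x : C) : (tensorLeft x).CommShift ℤ :=
  inferInstanceAs (((curriedTensor C).obj x).CommShift ℤ)
noncomputable instance (x : C) : (tensorRight x).CommShift ℤ :=
  inferInstanceAs (((curriedTensor C).flip.obj x).CommShift ℤ)
instance (x : C) : (tensorLeft x).IsTriangulated :=
  TensorTriangulated.isTriangulated_tensorLeft x
instance (x : C) : (tensorRight x).IsTriangulated :=
  TensorTriangulated.isTriangulated_tensorRight x
noncomputable instance (κ : C) : (twistedDual κ).CommShift ℤ :=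
  (TensorTriangulated.isTriangulated_internalHom κ).choose
instance (κ : C) : (twistedDual κ).IsTriangulated :=
  (TensorTriangulated.isTriangulated_internalHom κ).choose_spec

/-- The rigidity maps form a natural transformation. -/
@[simps]
def rigidityNatTrans (y : C) : twistedDual (𝟙_ C) ⋙ tensorRight y ⟶ twistedDual y where
  app x := rigidityMap x.unop y
  naturality x x' f := by
    apply MonoidalClosed.uncurry_injective
    change MonoidalClosed.uncurry ((MonoidalClosed.pre f.unop).app (𝟙_ C) ▷ y ≫
      rigidityMap x'.unop y) = MonoidalClosed.uncurry (rigidityMap x.unop y ≫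
        (MonoidalClosed.pre f.unop).app y)
    rw [MonoidalClosed.uncurry_natural_left, MonoidalClosed.uncurry_pre_app,
      uncurry_rigidityMap, uncurry_rigidityMap, associator_inv_naturality_middle_assoc,
      associator_inv_naturality_left_assoc, ← comp_whiskerRight_assoc,
      MonoidalClosed.id_tensor_pre_app_comp_ev, comp_whiskerRight_assoc]

variable [IsRigidlyCompactlyGenerated C]

omit [HasZeroObject C] [Pretriangulated C] [IsTriangulated C] [SymmetricCategory C]
  [TensorTriangulated C] in
-- Compact objects are shift-stable, so rigidity of x gives that of every shift. Thickness of the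
-- compact objects then comes from dévissage.
lemma compactObjects_iff_isIsoLocus (x : C) :
    compactObjects C x ↔ ∀ y : C, (isIsoLocus (rigidityNatTrans y)).unop x := by
  constructor
  · intro hx y n
    have h : compactObjects C (x⟦-n⟧) := compactObjects_shift hx (-n)
    rw [IsRigidlyCompactlyGenerated.compact_iff_rigid] at h
    have : IsIso ((rigidityNatTrans y).app ((shiftFunctor C (-n)).op.obj (op x))) := h y
    exact isIso_app_of_iso _ ((Pretriangulated.shiftFunctorOpIso C n (-n) (by simp)).app (op x))
  · intro hx
    rw [IsRigidlyCompactlyGenerated.compact_iff_rigid]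
    exact fun y => isIsoLocus_le _ (hx y)

instance : (compactObjects C).IsStableUnderRetracts where
  of_retract r hY := by
    rw [compactObjects_iff_isIsoLocus] at hY ⊢
    exact fun y => (isIsoLocus (rigidityNatTrans y)).prop_of_retract r.op (hY y)

instance : (compactObjects C).IsTriangulated where
  exists_zero := ⟨_, isZero_zero C, (compactObjects_iff_isIsoLocus _).2 fun y =>
    (isIsoLocus (rigidityNatTrans y)).unop.prop_of_isZero (isZero_zero C)⟩
  isStableUnderShiftBy n := ⟨fun _ hx => compactObjects_shift hx n⟩
  toIsTriangulatedClosed₂ := ObjectProperty.IsTriangulatedClosed₂.mk' fun T hT h₁ h₃ => by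
    rw [compactObjects_iff_isIsoLocus] at h₁ h₃ ⊢
    exact fun y => ObjectProperty.ext_of_isTriangulatedClosed₂ _ T hT (h₁ y) (h₃ y)

lemma isCompactSubmodule_compactObjects : IsCompactSubmodule (compactObjects C) where
  isTriangulated := inferInstance
  isStableUnderRetracts := inferInstance
  tensor_mem c x hc hx := by
    rw [IsRigidlyCompactlyGenerated.compact_iff_rigid] at hc hx ⊢
    exact hc.tensor hx

end TensorTriangulated

/-! ### Dualizing objects via biduality -/

section Dualizing

variable {C : Type u} [Category.{v} C] [HasZeroObject C] [Preadditive C] [HasShift C ℤ]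
  [∀ n : ℤ, (shiftFunctor C n).Additive] [Pretriangulated C]
  [MonoidalCategory C] [SymmetricCategory C] [MonoidalClosed C]

lemma isDualizingObject_iff (P : ObjectProperty C) (κ : C) :
    IsDualizingObject P κ ↔ IsCompactSubmodule P ∧ ∀ x, P x →
      P ((twistedDual κ).obj (op x)) ∧ IsIso (bidualityMap κ x) :=
  ⟨fun h => ⟨h.isCompactSubmodule, fun x hx => ⟨h.dual_mem x hx,
      (restrictedDual_isEquivalence_iff P κ h.dual_mem).1 h.isEquivalence x hx⟩⟩,
    fun h => ⟨h.1, fun x hx => (h.2 x hx).1,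
      (restrictedDual_isEquivalence_iff P κ fun x hx => (h.2 x hx).1).2 fun x hx => (h.2 x hx).2⟩⟩

omit [SymmetricCategory C] in
lemma IsDualizingObject.of_iso {P : ObjectProperty C} {κ κ' : C} (h : IsDualizingObject P κ)
    (e : κ ≅ κ') : IsDualizingObject P κ' := by
  have := h.isCompactSubmodule.isStableUnderRetracts
  let e' : twistedDual κ ≅ twistedDual κ' := MonoidalClosed.internalHom.flip.mapIso e
  have hP (x : C) (hx : P x) : P ((twistedDual κ').obj (op x)) :=
    P.prop_of_iso (e'.app (op x)) (h.dual_mem x hx)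
  have := h.isEquivalence
  exact ⟨h.isCompactSubmodule, hP, Functor.isEquivalence_of_iso
    (F := restrictedDual P κ h.dual_mem) (G := restrictedDual P κ' hP)
    (NatIso.ofComponents (fun x => P.isoMk (e'.app (op x.unop.obj))) (fun f =>
      P.hom_ext (e'.hom.naturality _)))⟩

lemma isDualizingObject_compactObjects [IsTriangulated C] [TensorTriangulated C]
    [IsRigidlyCompactlyGenerated C] : IsDualizingObject (compactObjects C) (𝟙_ C) := by
  refine (isDualizingObject_iff _ _).2 ⟨isCompactSubmodule_compactObjects, fun x hx => ?_⟩
  rw [IsRigidlyCompactlyGenerated.compact_iff_rigid] at hx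
  exact ⟨(IsRigidlyCompactlyGenerated.compact_iff_rigid _).2 hx.dual,
    isIso_bidualityMap_unit hx⟩

end Dualizing

/-! ### The projection formula and duality along an adjunction -/

section Adjoint

open Functor.LaxMonoidal Functor.OplaxMonoidal

variable {C : Type u₁} [Category.{v} C] [MonoidalCategory C] [SymmetricCategory C]
  {D : Type u₂} [Category.{v} D] [MonoidalCategory D] [SymmetricCategory D]
  {L : D ⥤ C} [L.Braided] {F : C ⥤ D} [F.LaxMonoidal] (adj₁ : L ⊣ F) [adj₁.IsMonoidal]

include adj₁ in
lemma rightAdjoint_μ_braiding (x y : C) :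
    μ F x y ≫ F.map (β_ x y).hom = (β_ (F.obj x) (F.obj y)).hom ≫ μ F y x := by
  apply (adj₁.homEquiv _ _).symm.injective
  simp only [Adjunction.homEquiv_counit, Functor.map_comp, assoc, adj₁.counit_naturality,
    adj₁.map_μ_comp_counit_app_tensor, adj₁.map_μ_comp_counit_app_tensor_assoc,
    Functor.map_braiding, Functor.Monoidal.μ_δ_assoc]
  simp

/-- The projection morphism `F x ⊗ d ⟶ F (x ⊗ L d)`. -/
def projectionMap (x : C) (d : D) : F.obj x ⊗ d ⟶ F.obj (x ⊗ L.obj d) :=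
  F.obj x ◁ adj₁.unit.app d ≫ μ F x (L.obj d)

lemma map_projectionMap_counit (x : C) (d : D) :
    L.map (projectionMap adj₁ x d) ≫ adj₁.counit.app _ =
      δ L (F.obj x) d ≫ adj₁.counit.app x ▷ L.obj d := by
  have h := adj₁.left_triangle_components d
  rw [projectionMap, Functor.map_comp, assoc, adj₁.map_μ_comp_counit_app_tensor]
  generalize adj₁.unit.app d = u at h ⊢
  change d ⟶ F.obj (L.obj d) at u
  change L.map u ≫ _ = _ at h
  change L.map (F.obj x ◁ u) ≫ _ = _
  rw [← δ_natural_right_assoc, tensorHom_def', ← MonoidalCategory.whiskerLeft_comp_assoc, h]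
  simp

/-- Hom(e, F x ⊗ d) ≅ Hom(e ⊗ d', F x) ≅ Hom(L e ⊗ L d', x) ≅ Hom(L e, x ⊗ L d) ≅ Hom(e, F(x ⊗ L
d)), since L d' is dual to L d. The computation checks that this chain is composition with the
projection map. -/
lemma isIso_projectionMap (x : C) (d d' : D) [ExactPairing d' d] :
    IsIso (projectionMap adj₁ x d) := by
  let := exactPairingMap L d' d
  refine isIso_of_comp_bijective _ fun e => ?_
  let Φ : (e ⟶ F.obj x ⊗ d) ≃ (e ⟶ F.obj (x ⊗ L.obj d)) :=
    (tensorRightHomEquiv e d' d (F.obj x)).symm.trans <|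
      (adj₁.homEquiv _ _).symm.trans <|
        ((Functor.Monoidal.μIso L e d').symm.homFromEquiv).trans <|
          (tensorRightHomEquiv (L.obj e) (L.obj d') (L.obj d) x).trans (adj₁.homEquiv _ _)
  convert! Φ.bijective using 1
  ext g
  obtain ⟨h, rfl⟩ := (tensorRightHomEquiv e d' d (F.obj x)).surjective g
  apply (adj₁.homEquiv _ _).symm.injective
  simp only [Φ, Equiv.trans_apply, Equiv.symm_apply_apply, Adjunction.homEquiv_counit,
    Functor.map_comp, assoc, map_projectionMap_counit]
  change L.map ((ρ_ _).inv ≫ _ ◁ η_ d' d ≫ (α_ _ _ _).inv ≫ h ▷ d) ≫ _ =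
    (ρ_ _).inv ≫ _ ◁ (ε L ≫ L.map (η_ d' d) ≫ δ L d' d) ≫ (α_ _ _ _).inv ≫
      (μ L e d' ≫ L.map h ≫ adj₁.counit.app x) ▷ _
  simp only [Functor.map_comp, Functor.Monoidal.map_whiskerLeft,
    Functor.Monoidal.map_whiskerRight, Functor.Monoidal.map_associator_inv,
    Functor.Monoidal.map_rightUnitor_inv]
  simp

variable [MonoidalClosed C] [MonoidalClosed D] {R : D ⥤ C} (adj₂ : F ⊣ R)

/-- The comparison map `F (ihom(x, R κ)) ⟶ ihom(F x, κ)`. -/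
def dualComparison (x : C) (κ : D) :
    F.obj ((ihom x).obj (R.obj κ)) ⟶ (ihom (F.obj x)).obj κ :=
  MonoidalClosed.curry (μ F x _ ≫ F.map ((ihom.ev x).app (R.obj κ)) ≫ adj₂.counit.app κ)

omit [SymmetricCategory C] [SymmetricCategory D] in
lemma uncurry_dualComparison (x : C) (κ : D) : MonoidalClosed.uncurry (dualComparison adj₂ x κ) =
    μ F x _ ≫ F.map ((ihom.ev x).app (R.obj κ)) ≫ adj₂.counit.app κ :=
  MonoidalClosed.uncurry_curry _

include adj₁ in
-- Hom(c, F hom(x, R κ)) ≅ Hom(x ⊗ L c, R κ) ≅ Hom(F(x ⊗ L c), κ) ≅ Hom(F x ⊗ c, κ), the last step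
-- by the projection formula.
lemma bijective_comp_dualComparison (x : C) (κ c : D) (hc : IsRigid c) :
    Function.Bijective (fun g : c ⟶ F.obj ((ihom x).obj (R.obj κ)) =>
      g ≫ dualComparison adj₂ x κ) := by
  let := exactPairingOfIsRigid c hc
  have := isIso_projectionMap adj₁ x c ((ihom c).obj (𝟙_ D))
  let Φ : (c ⟶ F.obj ((ihom x).obj (R.obj κ))) ≃ (c ⟶ (ihom (F.obj x)).obj κ) :=
    (adj₁.homEquiv _ _).symm.trans <| ((ihom.adjunction x).homEquiv _ _).symm.trans <|
      (adj₂.homEquiv _ _).symm.trans <| (asIso (projectionMap adj₁ x c)).symm.homFromEquiv.trans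
        ((ihom.adjunction (F.obj x)).homEquiv _ _)
  convert! Φ.bijective using 1
  ext g
  obtain ⟨g, rfl⟩ := (adj₁.homEquiv _ _).surjective g
  apply MonoidalClosed.uncurry_injective
  rw [MonoidalClosed.uncurry_natural_left, uncurry_dualComparison]
  refine Eq.trans ?_ (MonoidalClosed.uncurry_curry (projectionMap adj₁ x c ≫
    (adj₂.homEquiv _ _).symm (MonoidalClosed.uncurry g))).symm |>.trans ?_
  · rw [Adjunction.homEquiv_counit, MonoidalClosed.uncurry_eq, projectionMap,
      Adjunction.homEquiv_unit]
    simp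
  · congr 1
    simp [Φ]
    rfl

include adj₁ in
lemma bidualityMap_dualComparison (x : C) (κ : D) :
    F.map (bidualityMap (R.obj κ) x) ≫ dualComparison adj₂ _ κ =
      bidualityMap κ (F.obj x) ≫ (MonoidalClosed.pre (dualComparison adj₂ x κ)).app κ := by
  apply MonoidalClosed.uncurry_injective
  rw [MonoidalClosed.uncurry_natural_left, MonoidalClosed.uncurry_pre_app,
    uncurry_bidualityMap, uncurry_dualComparison, μ_natural_right_assoc,
    BraidedCategory.braiding_naturality_left_assoc, ← MonoidalClosed.uncurry_eq,
    uncurry_dualComparison, ← Functor.map_comp_assoc, ← MonoidalClosed.uncurry_eq,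
    uncurry_bidualityMap, Functor.map_comp, assoc,
    reassoc_of% (rightAdjoint_μ_braiding adj₁ (F := F))]

end Adjoint

/-! ### Transport of dualizing objects to thick closures -/

section Main

variable {C : Type u₁} [Category.{v} C] [HasZeroObject C] [Preadditive C] [HasShift C ℤ]
    [∀ n : ℤ, (shiftFunctor C n).Additive] [Pretriangulated C]
    {D : Type u₂} [Category.{v} D] [HasZeroObject D] [Preadditive D] [HasShift D ℤ]
    [∀ n : ℤ, (shiftFunctor D n).Additive] [Pretriangulated D] [IsTriangulated D]

omit [IsTriangulated D] in
lemma prop_obj_of_thick (P : ObjectProperty C) (F : C ⥤ D) [F.CommShift ℤ]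
    [F.IsTriangulated] (Q : ObjectProperty D) [Q.IsTriangulated] [Q.IsStableUnderRetracts]
    (h : ∀ x, P x → Q (F.obj x)) (x : C) (hx : thick P x) : Q (F.obj x) := by
  have : (Q.inverseImage F).IsStableUnderRetracts :=
    ⟨fun r hy => Q.prop_of_retract (r.map F) hy⟩
  exact (ObjectProperty.triangEnvelope_le_iff _ (Q := Q.inverseImage F)).2 h x hx

omit [IsTriangulated D] in
lemma prop_obj_op_of_thick (P : ObjectProperty C) (F : Cᵒᵖ ⥤ D) [F.CommShift ℤ]
    [F.IsTriangulated] (Q : ObjectProperty D) [Q.IsTriangulated] [Q.IsStableUnderRetracts]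
    (h : ∀ x, P x → Q (F.obj (op x))) (x : C) (hx : thick P x) : Q (F.obj (op x)) := by
  have : (Q.inverseImage F).unop.IsStableUnderRetracts :=
    ⟨fun r hy => Q.prop_of_retract (r.op.map F) hy⟩
  exact (ObjectProperty.triangEnvelope_le_iff _ (Q := (Q.inverseImage F).unop)).2 h x hx

lemma thick_map_thick_singleton (F : C ⥤ D) [F.CommShift ℤ] [F.IsTriangulated] (x : C) :
    thick ((thick (ObjectProperty.singleton x)).map F) =
      thick (ObjectProperty.singleton (F.obj x)) := by
  apply le_antisymm
  · refine (ObjectProperty.triangEnvelope_le_iff _).2 ?_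
    rintro y ⟨z, hz, ⟨e⟩⟩
    refine ObjectProperty.prop_of_iso _ e (prop_obj_of_thick _ F _ ?_ z hz)
    rintro _ ⟨⟩
    exact ObjectProperty.le_triangEnvelope _ _ ⟨()⟩
  · refine ObjectProperty.monotone_triangEnvelope ?_
    rintro _ ⟨⟩
    exact ⟨x, ObjectProperty.le_triangEnvelope _ _ ⟨()⟩, ⟨Iso.refl _⟩⟩

variable [IsTriangulated C]
    [MonoidalCategory C] [SymmetricCategory C] [MonoidalClosed C]
    [TensorTriangulated C] [IsRigidlyCompactlyGenerated C]
    [MonoidalCategory D] [SymmetricCategory D] [MonoidalClosed D]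
    [TensorTriangulated D] [IsRigidlyCompactlyGenerated D]
    {L : D ⥤ C} [L.Braided]
    {F : C ⥤ D} [F.CommShift ℤ] [F.LaxMonoidal] (adj₁ : L ⊣ F) [adj₁.IsMonoidal]

omit [IsTriangulated C] [TensorTriangulated C] [F.CommShift ℤ] in
include adj₁ in
-- Tensoring with c is exact, so it suffices to treat F x, where c ⊗ F x ≅ F(L c ⊗ x) with L c again
-- rigid, hence compact.
lemma isCompactSubmodule_thick_map {P : ObjectProperty C} (hP : IsCompactSubmodule P) :
    IsCompactSubmodule (thick (P.map F)) := by
  have := hP.isTriangulated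
  refine ⟨inferInstance, inferInstance, fun c y hc hy => ?_⟩
  refine prop_obj_of_thick (P.map F) (tensorLeft c) _ ?_ y hy
  rintro y ⟨x, hx, ⟨e⟩⟩
  rw [IsRigidlyCompactlyGenerated.compact_iff_rigid] at hc
  let := exactPairingOfIsRigid c hc
  have := isIso_projectionMap adj₁ x c ((ihom c).obj (𝟙_ D))
  refine ObjectProperty.le_triangEnvelope _ _ ⟨L.obj c ⊗ x, hP.tensor_mem _ _
    ((IsRigidlyCompactlyGenerated.compact_iff_rigid _).2 (hc.map L)) hx,
    ⟨F.mapIso (β_ (L.obj c) x) ≪≫ (asIso (projectionMap adj₁ x c)).symm ≪≫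
      β_ (F.obj x) c ≪≫ whiskerLeftIso c e⟩⟩

variable {R : D ⥤ C} (adj₂ : F ⊣ R)

omit [HasZeroObject C] [Preadditive C] [HasShift C ℤ] [∀ n : ℤ, (shiftFunctor C n).Additive]
  [Pretriangulated C] [IsTriangulated C] [TensorTriangulated C] [IsRigidlyCompactlyGenerated C]
  [IsTriangulated D] [TensorTriangulated D] [F.CommShift ℤ] in
include adj₁ in
lemma isIso_dualComparison (x : C) (κ : D) : IsIso (dualComparison adj₂ x κ) :=
  isIso_of_bijective_compactObjects _ fun c hc => bijective_comp_dualComparison adj₁ adj₂ x κ c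
    ((IsRigidlyCompactlyGenerated.compact_iff_rigid c).1 hc)

omit [HasZeroObject C] [Preadditive C] [HasShift C ℤ] [∀ n : ℤ, (shiftFunctor C n).Additive]
  [Pretriangulated C] [IsTriangulated C] [TensorTriangulated C] [IsRigidlyCompactlyGenerated C]
  [IsTriangulated D] [TensorTriangulated D] [F.CommShift ℤ] in
include adj₁ adj₂ in
-- In the square of `bidualityMap_dualComparison` the other three maps are invertible.
lemma isIso_bidualityMap_obj (x : C) (κ : D) [IsIso (bidualityMap (R.obj κ) x)] :
    IsIso (bidualityMap κ (F.obj x)) := by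
  have := isIso_dualComparison adj₁ adj₂ x κ
  have := isIso_dualComparison adj₁ adj₂ ((ihom x).obj (R.obj κ)) κ
  have h := bidualityMap_dualComparison adj₁ adj₂ x κ
  have h₁ : IsIso ((MonoidalClosed.pre (dualComparison adj₂ x κ)).app κ) :=
    inferInstanceAs (IsIso ((twistedDual κ).map (asIso (dualComparison adj₂ x κ)).hom.op))
  have : IsIso (bidualityMap κ (F.obj x) ≫
      (MonoidalClosed.pre (dualComparison adj₂ x κ)).app κ) := by
    rw [← h]; infer_instance
  exact IsIso.of_isIso_comp_right (bidualityMap κ (F.obj x))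
    ((MonoidalClosed.pre (dualComparison adj₂ x κ)).app κ)

omit [IsTriangulated C] [TensorTriangulated C] in
include adj₁ adj₂ in
/-- Matlis lifts of dualizing objects are dualizing. -/
theorem IsDualizingObject.thick_map {P : ObjectProperty C} {κ : D}
    (hP : IsDualizingObject P (R.obj κ)) : IsDualizingObject (thick (P.map F)) κ := by
  have := hP.isCompactSubmodule.isTriangulated
  have := isIso_dualComparison adj₁ adj₂
  rw [isDualizingObject_iff] at hP ⊢
  refine ⟨isCompactSubmodule_thick_map adj₁ hP.1, fun y hy => ⟨?_, ?_⟩⟩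
  · refine prop_obj_op_of_thick (P.map F) (twistedDual κ) _ ?_ y hy
    rintro y ⟨x, hx, ⟨e⟩⟩
    let e' := asIso (dualComparison adj₂ x κ)
    exact ObjectProperty.le_triangEnvelope _ _ ⟨_, (hP.2 x hx).1, ⟨e' ≪≫ (twistedDual κ).mapIso e.symm.op⟩⟩
  · refine isIsoLocus_le (bidualityNatTrans κ) (X := y) ?_
    refine (ObjectProperty.triangEnvelope_le_iff _).2 ?_ y hy
    rintro y ⟨x, hx, ⟨e⟩⟩ n
    -- The locus demands every shift: P is shift-stable and F commutes with shifts, so the case of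
    -- x⟦n⟧ suffices.
    have := (hP.2 _ (P.le_shift n _ hx)).2
    have : IsIso ((bidualityNatTrans κ).app ((shiftFunctor C n ⋙ F).obj x)) :=
      isIso_bidualityMap_obj adj₁ adj₂ (x⟦n⟧) κ
    exact isIso_app_of_iso _ ((shiftFunctor D n).mapIso e.symm ≪≫
      ((F.commShiftIso n).app x).symm)

end Main

end TTDuality

theorem mainTheorem10
    {C : Type u₁} [Category.{v} C] [HasZeroObject C] [Preadditive C] [HasShift C ℤ]
    [∀ n : ℤ, (shiftFunctor C n).Additive] [Pretriangulated C] [IsTriangulated C]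
    [MonoidalCategory C] [SymmetricCategory C] [MonoidalClosed C]
    [TTDuality.TensorTriangulated C] [TTDuality.IsRigidlyCompactlyGenerated C]
    {D : Type u₂} [Category.{v} D] [HasZeroObject D] [Preadditive D] [HasShift D ℤ]
    [∀ n : ℤ, (shiftFunctor D n).Additive] [Pretriangulated D] [IsTriangulated D]
    [MonoidalCategory D] [SymmetricCategory D] [MonoidalClosed D]
    [TTDuality.TensorTriangulated D] [TTDuality.IsRigidlyCompactlyGenerated D]
    (fStar : D ⥤ C) [fStar.CommShift ℤ] [fStar.IsTriangulated] [fStar.Braided]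
    (hcoprod : ∀ J : Type v, PreservesColimitsOfShape (Discrete J) fStar)
    (fPush : C ⥤ D) (adj₁ : fStar ⊣ fPush)
    (fTwist : D ⥤ C) (adj₂ : fPush ⊣ fTwist) :
    (∀ (C₀ : ObjectProperty C) (κ' : C) (κ : D),
      TTDuality.IsDualizingObject C₀ κ' → Nonempty (fTwist.obj κ ≅ κ') →
        TTDuality.IsDualizingObject (TTDuality.thick (C₀.map fPush)) κ) ∧
    (∀ I : D, Nonempty (yoneda.obj (𝟙_ C) ≅ fPush.op ⋙ yoneda.obj I) →
      Nonempty (fTwist.obj I ≅ 𝟙_ C) ∧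
      TTDuality.IsDualizingObject (TTDuality.compactObjects C) (𝟙_ C) ∧
      TTDuality.IsDualizingObject
        (TTDuality.thick ((TTDuality.compactObjects C).map fPush)) I ∧
      (TTDuality.compactObjects C = TTDuality.thick (ObjectProperty.singleton (𝟙_ C)) →
        TTDuality.IsDualizingObject
          (TTDuality.thick (ObjectProperty.singleton (fPush.obj (𝟙_ C)))) I)) := by
  -- The shift, triangulated and lax monoidal structures on f_* are those induced from its left
  -- adjoint.
  let := adj₁.rightAdjointCommShift ℤ
  have := adj₁.commShift_of_leftAdjoint ℤ
  let := adj₁.rightAdjointLaxMonoidal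
  have : fPush.IsTriangulated := adj₁.isTriangulated_rightAdjoint
  refine ⟨fun C₀ κ' κ h ⟨e⟩ => (h.of_iso e.symm).thick_map adj₁ adj₂, fun I ⟨e⟩ => ?_⟩
  have e' : fTwist.obj I ≅ 𝟙_ C :=
    -- Hom(x, f^(1) I) ≅ Hom(f_* x, I) ≅ Hom(x, 𝟙), naturally in x.
    Yoneda.fullyFaithful.preimageIso ((adj₂.representableBy I).toIso ≪≫ e.symm)
  have h := (TTDuality.isDualizingObject_compactObjects (C := C)).of_iso e'.symm
  refine ⟨⟨e'⟩, TTDuality.isDualizingObject_compactObjects, h.thick_map adj₁ adj₂, fun hC => ?_⟩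
  have h' := h.thick_map adj₁ adj₂
  rwa [hC, TTDuality.thick_map_thick_singleton] at h'
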